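/- Let $F$ be a finite forest, i.e. a finite acyclic simple graph (possibly disconnected or empty), with vertex set $V$, and let $\mathrm{Ind}(F)$ be its independence complex: the simplicial complex on $V$ whose faces are the independent sets of vertices of $F$ (including $\emptyset$). Here a simplicial complex on a finite set $X$ is any family of subsets of $X$ closed under taking subsets; a vertex is a face with one element. Topological statements refer to the geometric realization, i.e. the union of the convex hulls of the faces in the real vector space with basis $X$; the realization of $\{\emptyset\}$ is empty and is regarded as the sphere $S^{-1}$, while the complex $\emptyset$ without any face is regarded as contractible. For $a\in X$ put $$(\Delta:a)=\{m\in\Delta : a\notin m,\ m\cup\{a\}\in\Delta\},\qquad (\Delta,a)=\{m\in\Delta : a\notin m\}.$$ The class of grapes is defined recursively (as the smallest class with these properties): $\Delta$ is a grape if it has at most one vertex, or if there is $a\in X$ such that $(\Delta:a)$ is contractible in $(\Delta,a)$ (that is, $(\Delta:a)=\emptyset$ or the inclusion of realizations is homotopic to a constant map) and both $(\Delta,a)$ and $(\Delta:a)$ are grapes. Let $\gamma(F)$ be the minimal cardinality of a dominating set of $F$ (a set $D\subseteq V$ such that every vertex is in $D$ or adjacent to a vertex of $D$), and $i(F)$ the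 minimal cardinality of an independent dominating set of $F$. Then $\mathrm{Ind}(F)$ is a grape. Moreover, either $\mathrm{Ind}(F)$ is contractible, or $i(F)=\gamma(F)$ and $\mathrm{Ind}(F)$ is homotopy equivalent to the sphere of dimension $i(F)-1=\gamma(F)-1$. -/

import Mathlib

/-- A simplicial complex on the set `X`: a family of (finite) subsets of `X`, closed under passing
to subsets. Neither `∅` nor the singletons are required to be faces, so the void complex (no face
at all) and the complex `{∅}` are different objects. -/
@[ext]
structure SimplComplex (X : Type*) where
  faces : Set (Finset X)
  down_closed : ∀ {σ τ : Finset X}, σ ∈ faces → τ ⊆ σ → τ ∈ faces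

namespace SimplComplex

variable {X : Type*} [DecidableEq X]

/-- The link `(Δ : σ)`. -/
def link (Δ : SimplComplex X) (σ : Finset X) : SimplComplex X where
  faces := {m | m ∈ Δ.faces ∧ σ ∩ m = ∅ ∧ m ∪ σ ∈ Δ.faces}
  down_closed := by
    rintro m m' ⟨h1, h2, h3⟩ h
    exact ⟨Δ.down_closed h1 h,
      Finset.subset_empty.mp (h2 ▸ Finset.inter_subset_inter_left h),
      Δ.down_closed h3 (Finset.union_subset_union_left h)⟩

/-- The face-deletion `(Δ , σ)`. -/
def deletion (Δ : SimplComplex X) (σ : Finset X) : SimplComplex X where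
  faces := {m | m ∈ Δ.faces ∧ ¬ σ ⊆ m}
  down_closed := by
    rintro m m' ⟨h1, h2⟩ h
    exact ⟨Δ.down_closed h1 h, fun h' => h2 (h'.trans h)⟩

/-- The standard geometric realization, in the real vector space `X → ℝ` (for finite `X`, the
space with basis `X`): the union of the convex hulls of the faces, each `x : X` being identified
with the corresponding basis vector. It is empty for `{∅}` and for the void complex. -/
def realization (Δ : SimplComplex X) : Set (X → ℝ) :=
  ⋃ σ ∈ Δ.faces, convexHull ℝ ((fun x : X => (Pi.single x 1 : X → ℝ)) '' (σ : Set X))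

theorem realization_mono {Γ Δ : SimplComplex X} (h : Γ.faces ⊆ Δ.faces) :
    Γ.realization ⊆ Δ.realization :=
  Set.biUnion_subset_biUnion_left h

/-- `Γ` is a subcomplex of `Δ` that is contractible in `Δ`: the inclusion of the realizations is
homotopic to a constant map. By convention the void complex is contractible. -/
def ContractibleIn (Γ Δ : SimplComplex X) : Prop :=
  ∃ h : Γ.faces ⊆ Δ.faces,
    Γ.faces = ∅ ∨ (ContinuousMap.inclusion (realization_mono h)).Nullhomotopic

/-- Grapes. The recursion is well-founded: the predicate is the least one with these closure
properties. -/
inductive IsGrape : SimplComplex X → Prop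
  | of_at_most_one_vertex (Δ : SimplComplex X)
      (h : ∀ x y : X, {x} ∈ Δ.faces → {y} ∈ Δ.faces → x = y) : IsGrape Δ
  | step (Δ : SimplComplex X) (a : X)
      (hcontr : ContractibleIn (Δ.link {a}) (Δ.deletion {a}))
      (hdel : IsGrape (Δ.deletion {a})) (hlink : IsGrape (Δ.link {a})) : IsGrape Δ

end SimplComplex

namespace SimpleGraph

variable {V : Type*}

/-- The independence complex `Ind(G)`: its faces are the independent sets of vertices. -/
def indComplex (G : SimpleGraph V) : SimplComplex V where
  faces := {σ | G.IsIndepSet (σ : Set V)}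
  down_closed := fun h hτ => Set.Pairwise.mono (Finset.coe_subset.mpr hτ) h

/-- The closed neighborhood `N[S]`. -/
def closedNbhd (G : SimpleGraph V) (S : Set V) : Set V :=
  {w | ∃ s ∈ S, G.Adj s w} ∪ S

/-- `D` is a dominating set: `N[D] = V`. -/
def IsDominatingSet (G : SimpleGraph V) (D : Set V) : Prop :=
  G.closedNbhd D = Set.univ

/-- The domination number `γ(G)` (of a finite graph). -/
noncomputable def domNumber (G : SimpleGraph V) : ℕ :=
  sInf {n | ∃ D : Finset V, G.IsDominatingSet (D : Set V) ∧ D.card = n}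

/-- The independent domination number `i(G)` (of a finite graph). -/
noncomputable def indepDomNumber (G : SimpleGraph V) : ℕ :=
  sInf {n | ∃ D : Finset V, G.IsIndepSet (D : Set V) ∧ G.IsDominatingSet (D : Set V) ∧ D.card = n}

end SimpleGraph

/-! Everything is proved for induced subgraphs on a finite set `S` of vertices, by induction on `S`.

Grape: if `S` has at least two vertices, some `a` can be deleted so that an isolated vertex remains:
any vertex other than an isolated one if `S` already has one, otherwise the neighbour of a leaf. The
deletion of `a` is then a cone, so the link of `a` is contractible in it.

Homotopy type: an isolated vertex makes the complex a cone. Otherwise take a leaf `u` with neighbour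
`w`, and let `T` be `S` without the closed neighbourhood of `w`. Folding the neighbours of `w` onto
`u` shows that the complex on `S` is the suspension of the complex on `T` up to homotopy
(`indOn_homotopyEquiv_susp`). Suspension preserves contractibility and raises the dimension of a
sphere by one.

Domination numbers have to follow the dimension. Adding `w` to an independent dominating set of `T`
gives one of `S` with one more element. Conversely, every dominating set of `S` must yield one of
`T` with at least one element fewer. This is `DominatesOn.exists_removeNbhd`; it uses a leaf near
the end of the forest (`IsAcyclic.exists_end_leaf`) and the absence of isolated vertices in `T`. If
`T` has an isolated vertex, the complex is contractible and no count is needed. -/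

namespace SimpleGraph

/-! ### Leaves and dominating sets in forests -/

variable {V : Type*}

/-- `x` has at most one neighbour in `S`. -/
def IsLeafIn (F : SimpleGraph V) (S : Finset V) (x : V) : Prop :=
  ∀ b ∈ S, ∀ c ∈ S, F.Adj x b → F.Adj x c → b = c

/-- `D` is a dominating set of the subgraph induced on `S`. -/
def DominatesOn (F : SimpleGraph V) (S D : Finset V) : Prop :=
  D ⊆ S ∧ ∀ x ∈ S, x ∈ D ∨ ∃ d ∈ D, F.Adj d x

open Classical in
/-- `S` without the closed neighbourhood of `w`. -/
noncomputable def removeNbhd (F : SimpleGraph V) (S : Finset V) (w : V) : Finset V :=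
  S.filter fun x => x ≠ w ∧ ¬ F.Adj w x

theorem mem_removeNbhd {F : SimpleGraph V} {S : Finset V} {w x : V} :
    x ∈ F.removeNbhd S w ↔ x ∈ S ∧ x ≠ w ∧ ¬ F.Adj w x := by
  simp [removeNbhd]

/-- A connected component of the induced subgraph is a tree: a single vertex, which satisfies
`IsLeafIn` vacuously, or a nontrivial tree, which has a vertex of degree one. -/
theorem IsAcyclic.exists_isLeafIn {F : SimpleGraph V} (hF : F.IsAcyclic) (S : Finset V)
    (hS : S.Nonempty) : ∃ a ∈ S, F.IsLeafIn S a := by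
  classical
  obtain ⟨a, ha⟩ := hS
  let G := F.induce (S : Set V)
  let c := G.connectedComponentMk ⟨a, ha⟩
  have hT := (hF.induce (S : Set V)).isTree_connectedComponent c
  have hnb : ∀ (x : c) (b : V) (hb : b ∈ S), F.Adj x.1.1 b →
      ∃ h : (⟨b, hb⟩ : (S : Set V)) ∈ c, c.toSimpleGraph.Adj x ⟨⟨b, hb⟩, h⟩ := by
    intro x b hb hxb
    have h1 : G.Adj x.1 ⟨b, hb⟩ := hxb
    have hx : G.connectedComponentMk x.1 = c := x.2
    refine ⟨?_, h1⟩
    change G.connectedComponentMk _ = c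
    rw [← hx]
    exact (ConnectedComponent.connectedComponentMk_eq_of_adj h1).symm
  rcases subsingleton_or_nontrivial c with h | h
  · refine ⟨a, ha, fun b hb _ _ hab _ => ?_⟩
    obtain ⟨h1, h2⟩ := hnb ⟨⟨a, ha⟩, rfl⟩ b hb hab
    exact absurd (Subsingleton.elim _ _) h2.ne
  · have : Fintype c := Fintype.ofFinite _
    obtain ⟨x, hx⟩ := hT.exists_vert_degree_one_of_nontrivial
    obtain ⟨y, -, hy⟩ := (degree_eq_one_iff_existsUnique_adj).1 hx
    refine ⟨x.1.1, x.1.2, fun b hb d hd hxb hxd => ?_⟩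
    obtain ⟨h1, h2⟩ := hnb x b hb hxb
    obtain ⟨h3, h4⟩ := hnb x d hd hxd
    have := (hy _ h2).trans (hy _ h4).symm
    exact congrArg (fun z : c => z.1.1) this

/-- In a finite forest without isolated vertices there is a leaf `u` with neighbour `w` lying
at the end of the forest: `w` has at most one neighbour `v` that is not a leaf, and `v` has at most
one neighbour `p ≠ w` that is neither a leaf nor adjacent to a leaf. -/
theorem IsAcyclic.exists_end_leaf {F : SimpleGraph V} (hF : F.IsAcyclic) (S : Finset V)
    (hS : S.Nonempty) (hiso : ∀ x ∈ S, ∃ y ∈ S, F.Adj x y) :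
    ∃ u ∈ S, ∃ w ∈ S, F.Adj u w ∧ F.IsLeafIn S u ∧
      ((∀ x ∈ S, F.Adj w x → F.IsLeafIn S x) ∨
        ∃ v ∈ S, F.Adj w v ∧ ¬ F.IsLeafIn S v ∧
          (∀ x ∈ S, F.Adj w x → x ≠ v → F.IsLeafIn S x) ∧
          ∃ p, ∀ x ∈ S, F.Adj v x → x ≠ w → x ≠ p →
            F.IsLeafIn S x ∨ ∃ y ∈ S, F.Adj x y ∧ F.IsLeafIn S y) := by
  classical
  -- Prune the leaves twice. A leaf `v` of `S₂` sits next to a leaf `w` of `S₁`, which in turn sits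
  -- next to a leaf `u` of `S`; `p` is the possible neighbour of `v` in `S₂`.
  let S₁ := S.filter fun x => ¬ F.IsLeafIn S x
  let S₂ := S₁.filter fun x => ¬ F.IsLeafIn S₁ x
  have m₁ : ∀ x, x ∈ S₁ ↔ x ∈ S ∧ ¬ F.IsLeafIn S x := fun x => by simp [S₁]
  have m₂ : ∀ x, x ∈ S₂ ↔ x ∈ S₁ ∧ ¬ F.IsLeafIn S₁ x := fun x => by simp [S₂]
  -- If no neighbour of `x` had been pruned, `x` would already be a leaf of `S`.
  have key : ∀ x ∈ S₁, F.IsLeafIn S₁ x → ∃ y ∈ S, F.Adj x y ∧ F.IsLeafIn S y := by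
    intro x hx hl
    by_contra! hcon
    obtain ⟨hxS, hnl⟩ := (m₁ x).1 hx
    refine hnl fun b hb c hc hxb hxc => ?_
    exact hl b ((m₁ b).2 ⟨hb, hcon b hb hxb⟩) c ((m₁ c).2 ⟨hc, hcon c hc hxc⟩) hxb hxc
  rcases S₁.eq_empty_or_nonempty with h1 | h1
  · obtain ⟨u, hu⟩ := hS
    obtain ⟨w, hw, huw⟩ := hiso u hu
    have hl : ∀ x ∈ S, F.IsLeafIn S x := by
      intro x hx
      by_contra hn
      have := (m₁ x).2 ⟨hx, hn⟩
      simp [h1] at this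
    exact ⟨u, hu, w, hw, huw, hl u hu, Or.inl fun x hx _ => hl x hx⟩
  have main : ∃ w ∈ S₁, F.IsLeafIn S₁ w ∧ ∀ v ∈ S₁, F.Adj w v →
      ∃ p, ∀ x ∈ S₁, F.Adj v x → x ≠ w → x ≠ p → F.IsLeafIn S₁ x := by
    rcases S₂.eq_empty_or_nonempty with h2 | h2
    · have hl : ∀ x ∈ S₁, F.IsLeafIn S₁ x := by
        intro x hx
        by_contra hn
        have := (m₂ x).2 ⟨hx, hn⟩
        simp [h2] at this
      obtain ⟨w, hw⟩ := h1
      exact ⟨w, hw, hl w hw, fun v _ _ => ⟨w, fun x hx _ _ _ => hl x hx⟩⟩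
    · obtain ⟨v, hv, hvl⟩ := hF.exists_isLeafIn S₂ h2
      obtain ⟨hv1, hvn⟩ := (m₂ v).1 hv
      -- Otherwise `v` has the same neighbours in `S₁` as in `S₂`, and would have been pruned.
      have : ∃ w ∈ S₁, F.Adj v w ∧ F.IsLeafIn S₁ w := by
        by_contra! hcon
        refine hvn fun b hb c hc hvb hvc => ?_
        exact hvl b ((m₂ b).2 ⟨hb, hcon b hb hvb⟩) c ((m₂ c).2 ⟨hc, hcon c hc hvc⟩) hvb hvc
      obtain ⟨w, hw, hvw, hwl⟩ := this
      refine ⟨w, hw, hwl, fun v' hv' hwv' => ?_⟩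
      obtain rfl := hwl v hv1 v' hv' hvw.symm hwv'
      by_cases hp : ∃ p ∈ S₂, F.Adj v p
      · obtain ⟨p, hp, hvp⟩ := hp
        refine ⟨p, fun x hx hvx _ hxp => ?_⟩
        by_contra hn
        exact hxp (hvl x ((m₂ x).2 ⟨hx, hn⟩) p hp hvx hvp)
      · refine ⟨w, fun x hx hvx _ _ => ?_⟩
        by_contra hn
        exact hp ⟨x, (m₂ x).2 ⟨hx, hn⟩, hvx⟩
  obtain ⟨w, hw, hwl, hmain⟩ := main
  obtain ⟨u, hu, hwu, hul⟩ := key w hw hwl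
  refine ⟨u, hu, w, ((m₁ w).1 hw).1, hwu.symm, hul, ?_⟩
  by_cases hall : ∀ x ∈ S, F.Adj w x → F.IsLeafIn S x
  · exact Or.inl hall
  · push Not at hall
    obtain ⟨v, hv, hwv, hvn⟩ := hall
    have hv1 := (m₁ v).2 ⟨hv, hvn⟩
    obtain ⟨p, hp⟩ := hmain v hv1 hwv
    refine Or.inr ⟨v, hv, hwv, hvn, fun x hx hwx hxv => ?_, p, fun x hx hvx hxw hxp => ?_⟩
    · by_contra hn
      exact hxv (hwl x ((m₁ x).2 ⟨hx, hn⟩) v hv1 hwx hwv)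
    · by_contra! hcon
      have hx1 := (m₁ x).2 ⟨hx, hcon.1⟩
      obtain ⟨y, hy, hxy, hyl⟩ := key x hx1 (hp x hx1 hvx hxw hxp)
      exact hcon.2 y hy hxy hyl

/-- Removing the closed neighbourhood of the neighbour `w` of a leaf `u` as in
`SimpleGraph.IsAcyclic.exists_end_leaf` decreases the size of a minimal dominating set, unless an
isolated vertex is created. -/
theorem DominatesOn.exists_removeNbhd {F : SimpleGraph V} {S D : Finset V} {u w : V}
    (hD : F.DominatesOn S D) (hu : u ∈ S) (hw : w ∈ S) (huw : F.Adj u w) (hul : F.IsLeafIn S u)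
    (hend : (∀ x ∈ S, F.Adj w x → F.IsLeafIn S x) ∨
        ∃ v ∈ S, F.Adj w v ∧ ¬ F.IsLeafIn S v ∧
          (∀ x ∈ S, F.Adj w x → x ≠ v → F.IsLeafIn S x) ∧
          ∃ p, ∀ x ∈ S, F.Adj v x → x ≠ w → x ≠ p →
            F.IsLeafIn S x ∨ ∃ y ∈ S, F.Adj x y ∧ F.IsLeafIn S y)
    (hiso : ∀ x ∈ F.removeNbhd S w, ∃ y ∈ F.removeNbhd S w, F.Adj x y) :
    ∃ D', F.DominatesOn (F.removeNbhd S w) D' ∧ D'.card + 1 ≤ D.card := by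
  classical
  obtain ⟨hDS, hDd⟩ := hD
  -- Only `u` and its sole neighbour `w` can dominate `u`; this element of `D` is lost on passing to
  -- `T`.
  have huwD : ∃ d ∈ D, d = u ∨ d = w := by
    rcases hDd u hu with h | ⟨d, hd, hdu⟩
    · exact ⟨u, h, Or.inl rfl⟩
    · exact ⟨d, hd, Or.inr (hul d (hDS hd) w hw hdu.symm huw)⟩
  obtain ⟨d₀, hd₀, hd₀'⟩ := huwD
  have hd₀T : d₀ ∉ F.removeNbhd S w := by
    rw [mem_removeNbhd]
    rcases hd₀' with rfl | rfl
    · exact fun h => h.2.2 huw.symm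
    · exact fun h => h.2.1 rfl
  -- vertices of `S` next to `w` that are leaves dominate nothing that is left
  have hleaf : ∀ z ∈ F.removeNbhd S w, ∀ d ∈ S, F.Adj w d → F.IsLeafIn S d → ¬ F.Adj d z := by
    intro z hz d _ hwd hdl hdz
    rw [mem_removeNbhd] at hz
    exact hz.2.1 (hdl z hz.1 w hw hdz hwd.symm)
  -- If no neighbour of `w` in `D` dominates anything that is left, the part of `D` that is left
  -- suffices.
  have simple : (∀ z ∈ F.removeNbhd S w, ∀ d ∈ D, F.Adj w d → ¬ F.Adj d z) →
      ∃ D', F.DominatesOn (F.removeNbhd S w) D' ∧ D'.card + 1 ≤ D.card := by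
    intro h
    refine ⟨D.filter (· ∈ F.removeNbhd S w), ⟨fun x hx => (Finset.mem_filter.1 hx).2, ?_⟩, ?_⟩
    · intro z hz
      have hz' := mem_removeNbhd.1 hz
      rcases hDd z hz'.1 with hzD | ⟨d, hd, hdz⟩
      · exact Or.inl (Finset.mem_filter.2 ⟨hzD, hz⟩)
      · refine Or.inr ⟨d, Finset.mem_filter.2 ⟨hd, mem_removeNbhd.2 ⟨hDS hd, ?_, ?_⟩⟩, hdz⟩
        · rintro rfl
          exact hz'.2.2 hdz
        · exact fun hwd => h z hz d hd hwd hdz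
    · exact Finset.card_lt_card (Finset.filter_ssubset.2 ⟨d₀, hd₀, hd₀T⟩)
  rcases hend with hend | ⟨v, hv, hwv, hvn, hwl, p, hp⟩
  · exact simple fun z hz d hd hwd => hleaf z hz d (hDS hd) hwd (hend d (hDS hd) hwd)
  by_cases hvD : v ∈ D
  swap
  · refine simple fun z hz d hd hwd => hleaf z hz d (hDS hd) hwd (hwl d (hDS hd) hwd ?_)
    rintro rfl
    exact hvD hd
  set T := F.removeNbhd S w with hT
  have hTS : ∀ {x}, x ∈ T → x ∈ S := fun hx => (mem_removeNbhd.1 hx).1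
  have hvT : v ∉ T := fun h => (mem_removeNbhd.1 h).2.2 hwv
  have hvd₀ : v ≠ d₀ := by
    rintro rfl
    rcases hd₀' with rfl | rfl
    · exact hvn hul
    · exact hwv.ne rfl
  -- a leaf of `S` surviving in `T` has its neighbour in `T`
  choose! nb hnbT hnb using hiso
  -- Replacing a leaf by its neighbour loses nothing: in `T`, the closed neighbourhood of `x` is
  -- contained in that of `φ x`.
  let φ : V → V := fun x => if F.IsLeafIn S x then nb x else x
  have hφT : ∀ x ∈ T, φ x ∈ T := by
    intro x hx
    simp only [φ]
    split_ifs
    exacts [hnbT x hx, hx]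
  -- Both `v` and `d₀` drop out of `D`, so there is room for one new vertex, and `p` takes it.
  refine ⟨(D.filter (· ∈ T)).image φ ∪ ({p} : Finset V).filter (· ∈ T), ⟨?_, ?_⟩, ?_⟩
  · intro x hx
    rcases Finset.mem_union.1 hx with h | h
    · obtain ⟨y, hy, rfl⟩ := Finset.mem_image.1 h
      exact hφT y (Finset.mem_filter.1 hy).2
    · exact (Finset.mem_filter.1 h).2
  · have hmem : ∀ d ∈ D, d ∈ T → φ d ∈ (D.filter (· ∈ T)).image φ ∪
        ({p} : Finset V).filter (· ∈ T) := fun d hd hdT =>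
      Finset.mem_union_left _ (Finset.mem_image_of_mem _ (Finset.mem_filter.2 ⟨hd, hdT⟩))
    have hinT : ∀ d ∈ D, d ∈ T → ∀ z ∈ T, z = d ∨ F.Adj d z →
        z ∈ (D.filter (· ∈ T)).image φ ∪ ({p} : Finset V).filter (· ∈ T) ∨
        ∃ e ∈ (D.filter (· ∈ T)).image φ ∪ ({p} : Finset V).filter (· ∈ T), F.Adj e z := by
      intro d hd hdT z hz hdz
      by_cases hdl : F.IsLeafIn S d
      · have hφd : φ d = nb d := if_pos hdl
        rcases hdz with rfl | hdz
        · exact Or.inr ⟨φ z, hmem z hd hdT, hφd ▸ (hnb z hdT).symm⟩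
        · left
          rw [hdl z (hTS hz) (nb d) (hTS (hnbT d hdT)) hdz (hnb d hdT), ← hφd]
          exact hmem d hd hdT
      · have hφd : φ d = d := if_neg hdl
        have := hmem d hd hdT
        rw [hφd] at this
        rcases hdz with rfl | hdz
        · exact Or.inl this
        · exact Or.inr ⟨d, this, hdz⟩
    intro z hz
    have hz' := mem_removeNbhd.1 hz
    rcases hDd z hz'.1 with hzD | ⟨d, hd, hdz⟩
    · exact hinT z hzD hz z hz (Or.inl rfl)
    by_cases hdT : d ∈ T
    · exact hinT d hd hdT z hz (Or.inr hdz)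
    have hdv : d = v := by
      by_contra hne
      refine hdT (mem_removeNbhd.2 ⟨hDS hd, ?_, fun hwd => ?_⟩)
      · rintro rfl
        exact hz'.2.2 hdz
      · exact hleaf z hz d (hDS hd) hwd (hwl d (hDS hd) hwd hne) hdz
    subst hdv
    by_cases hzp : z = p
    · subst hzp
      exact Or.inl (Finset.mem_union_right _ (by simp [hz]))
    -- Here `z` was dominated by `v`. If `z` were a leaf, `v` would be its only neighbour and `z`
    -- would be isolated in `T`. Otherwise `z` has a leaf `y` next to it, and `D` can dominate `y`
    -- only through `y` or `z`, both in `T`.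
    rcases hp z hz'.1 hdz hz'.2.1 hzp with hzl | ⟨y, hy, hzy, hyl⟩
    · have := hzl d (hDS hd) (nb z) (hTS (hnbT z hz)) hdz.symm (hnb z hz)
      exact absurd (this ▸ hnbT z hz) hvT
    · have hyT : y ∈ T := by
        refine mem_removeNbhd.2 ⟨hy, ?_, fun hwy => ?_⟩
        · rintro rfl
          exact hz'.2.2 hzy.symm
        · exact hz'.2.1 (hyl z hz'.1 w hw hzy.symm hwy.symm)
      rcases hDd y hy with hyD | ⟨e, he, hey⟩
      · exact hinT y hyD hyT z hz (Or.inr hzy.symm)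
      · obtain rfl := hyl e (hDS he) z hz'.1 hey.symm hzy.symm
        exact hinT e he hz e hz (Or.inl rfl)
  · have h1 : (D.filter (· ∈ T)).card + 2 ≤ D.card := by
      have hsub : D.filter (· ∈ T) ⊆ (D.erase v).erase d₀ := by
        intro x hx
        rw [Finset.mem_filter] at hx
        refine Finset.mem_erase.2 ⟨?_, Finset.mem_erase.2 ⟨?_, hx.1⟩⟩
        · rintro rfl; exact hd₀T hx.2
        · rintro rfl; exact hvT hx.2
      have h2 := Finset.card_le_card hsub
      have h3 := Finset.card_erase_add_one hvD
      have h4 := Finset.card_erase_add_one (Finset.mem_erase.2 ⟨hvd₀.symm, hd₀⟩)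
      omega
    have h5 : (({p} : Finset V).filter (· ∈ T)).card ≤ 1 :=
      (Finset.card_filter_le _ _).trans (by simp)
    have h6 := Finset.card_union_le ((D.filter (· ∈ T)).image φ) (({p} : Finset V).filter (· ∈ T))
    have h7 := Finset.card_image_le (s := D.filter (· ∈ T)) (f := φ)
    omega

/-- A neighbour of a leaf completes an independent dominating set of what is left after removing
its closed neighbourhood. -/
theorem DominatesOn.insert_of_removeNbhd [DecidableEq V] {F : SimpleGraph V} {S D : Finset V}
    {w : V} (hD : F.DominatesOn (F.removeNbhd S w) D) (hw : w ∈ S)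
    (hI : F.IsIndepSet (D : Set V)) :
    F.DominatesOn S (insert w D) ∧ F.IsIndepSet (insert w D : Finset V) ∧
      (insert w D).card = D.card + 1 := by
  have hDT : ∀ x ∈ D, x ∈ S ∧ x ≠ w ∧ ¬ F.Adj w x := fun x hx => mem_removeNbhd.1 (hD.1 hx)
  refine ⟨⟨?_, ?_⟩, ?_, Finset.card_insert_of_notMem fun h => (hDT w h).2.1 rfl⟩
  · exact Finset.insert_subset hw fun x hx => (hDT x hx).1
  · intro x hx
    by_cases hxw : x = w
    · exact Or.inl (by simp [hxw])
    by_cases hwx : F.Adj w x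
    · exact Or.inr ⟨w, by simp, hwx⟩
    rcases hD.2 x (mem_removeNbhd.2 ⟨hx, hxw, hwx⟩) with h | ⟨d, hd, hdx⟩
    · exact Or.inl (Finset.mem_insert_of_mem h)
    · exact Or.inr ⟨d, Finset.mem_insert_of_mem hd, hdx⟩
  · rw [Finset.coe_insert]
    refine hI.insert fun b hb _ => ⟨(hDT b hb).2.2, fun h => (hDT b hb).2.2 h.symm⟩

end SimpleGraph

/-! ### Suspensions of subsets of normed spaces -/

namespace TopologicalSuspension

open Topology unitInterval

variable {E E' E'' : Type*} [NormedAddCommGroup E] [NormedSpace ℝ E]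
  [NormedAddCommGroup E'] [NormedSpace ℝ E'] [NormedAddCommGroup E''] [NormedSpace ℝ E'']

/-- A model of the unreduced suspension of a subset `A` of a normed space, with apices `(±1, 0)`:
over `t ∈ (-1, 1)` lies the copy `(1 - |t|) • A` of `A`. -/
def susp (A : Set E) : Set (ℝ × E) :=
  {q | (|q.1| = 1 ∧ q.2 = 0) ∨ (|q.1| < 1 ∧ (1 - |q.1|)⁻¹ • q.2 ∈ A)}

theorem susp_inv_smul_mem {A : Set E} (q : susp A) (h : |q.1.1| < 1) :
    (1 - |q.1.1|)⁻¹ • q.1.2 ∈ A := by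
  rcases q.2 with h' | h'
  · exact absurd h'.1 h.ne
  · exact h'.2

theorem susp_snd_eq_zero {A : Set E} (q : susp A) (h : ¬ |q.1.1| < 1) : q.1.2 = 0 := by
  rcases q.2 with h' | h'
  · exact h'.2
  · exact absurd h'.1 h

theorem susp_abs_le {A : Set E} (q : susp A) : |q.1.1| ≤ 1 := by
  rcases q.2 with h' | h'
  · exact h'.1.le
  · exact h'.1.le

open Classical in
/-- The second coordinate of the suspension of a map. -/
noncomputable def suspSnd {A : Set E} {B : Set E'} (f : A → B) (q : susp A) : E' :=
  if h : |q.1.1| < 1 then (1 - |q.1.1|) • (f ⟨_, susp_inv_smul_mem q h⟩ : E') else 0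

theorem suspSnd_of_lt {A : Set E} {B : Set E'} (f : A → B) (q : susp A) (h : |q.1.1| < 1) :
    suspSnd f q = (1 - |q.1.1|) • (f ⟨_, susp_inv_smul_mem q h⟩ : E') :=
  dif_pos h

theorem suspSnd_of_not_lt {A : Set E} {B : Set E'} (f : A → B) (q : susp A)
    (h : ¬ |q.1.1| < 1) : suspSnd f q = 0 :=
  dif_neg h

theorem inv_smul_suspSnd {A : Set E} {B : Set E'} (f : A → B) (q : susp A) (h : |q.1.1| < 1) :
    (1 - |q.1.1|)⁻¹ • suspSnd f q = f ⟨_, susp_inv_smul_mem q h⟩ := by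
  rw [suspSnd, dif_pos h, smul_smul, inv_mul_cancel₀ (by linarith), one_smul]

/-- The suspension of a map. -/
noncomputable def suspFun {A : Set E} {B : Set E'} (f : A → B) (q : susp A) : susp B :=
  ⟨(q.1.1, suspSnd f q), by
    by_cases h : |q.1.1| < 1
    · refine Or.inr ⟨h, ?_⟩
      simp only
      rw [inv_smul_suspSnd f q h]
      exact (f _).2
    · exact Or.inl ⟨le_antisymm (susp_abs_le q) (not_lt.1 h), dif_neg h⟩⟩

theorem suspFun_id {A : Set E} (q : susp A) : suspFun (fun a : A => a) q = q := by
  refine Subtype.ext (Prod.ext rfl ?_)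
  by_cases h : |q.1.1| < 1
  · simp only [suspFun, suspSnd, dif_pos h, smul_smul]
    rw [mul_inv_cancel₀ (by linarith), one_smul]
  · simp only [suspFun, suspSnd, dif_neg h, susp_snd_eq_zero q h]

theorem suspFun_comp {A : Set E} {B : Set E'} {C : Set E''} (g : B → C) (f : A → B) (q : susp A) :
    suspFun (fun a => g (f a)) q = suspFun g (suspFun f q) := by
  refine Subtype.ext (Prod.ext rfl ?_)
  change suspSnd (fun a => g (f a)) q = suspSnd g (suspFun f q)
  by_cases h : |q.1.1| < 1
  · refine (suspSnd_of_lt _ q h).trans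
      (Eq.trans ?_ (suspSnd_of_lt g (suspFun f q) h).symm)
    exact congrArg (fun b => (1 - |q.1.1|) • (g b : E''))
      (Subtype.ext (inv_smul_suspSnd f q h).symm)
  · exact (suspSnd_of_not_lt _ q h).trans (suspSnd_of_not_lt g (suspFun f q) h).symm

/-- The parameter space `P` allows homotopies to be suspended. Away from the apices the formula is
continuous; at an apex the factor `1 - |t|` tends to zero, and boundedness of `B` makes the second
coordinate tend to zero too. -/
theorem continuous_suspFun {P : Type*} [TopologicalSpace P] {A : Set E} {B : Set E'}
    (hB : Bornology.IsBounded B) (f : P → A → B) (hf : Continuous fun x : P × A => f x.1 x.2) :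
    Continuous fun x : P × susp A => suspFun (f x.1) x.2 := by
  refine Continuous.subtype_mk (Continuous.prodMk (by fun_prop) ?_) _
  rw [continuous_iff_continuousAt]
  intro x
  by_cases h : |x.2.1.1| < 1
  · let U : Set (P × susp A) := {y | |y.2.1.1| < 1}
    have hU : IsOpen U := isOpen_lt (by fun_prop) continuous_const
    refine ContinuousOn.continuousAt ?_ (hU.mem_nhds h)
    rw [continuousOn_iff_continuous_domRestrict]
    have hne : ∀ y : U, 1 - |y.1.2.1.1| ≠ 0 := fun y => by
      have : |y.1.2.1.1| < 1 := y.2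
      linarith
    have : U.domRestrict (fun y : P × susp A => suspSnd (f y.1) y.2) = fun y : U =>
        (1 - |y.1.2.1.1|) • (f y.1.1 ⟨_, susp_inv_smul_mem y.1.2 y.2⟩ : E') := by
      funext y
      exact dif_pos y.2
    rw [this]
    refine Continuous.smul (by fun_prop) (continuous_subtype_val.comp ?_)
    refine hf.comp (Continuous.prodMk (by fun_prop) (Continuous.subtype_mk ?_ _))
    exact Continuous.smul (Continuous.inv₀ (by fun_prop) hne) (by fun_prop)
  · obtain ⟨C, hC⟩ := hB.exists_norm_le
    have h1 : |x.2.1.1| = 1 := le_antisymm (susp_abs_le _) (not_lt.1 h)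
    have h0 : suspSnd (f x.1) x.2 = 0 := dif_neg h
    rw [ContinuousAt, h0]
    refine squeeze_zero_norm (a := fun y : P × susp A => (1 - |y.2.1.1|) * C) (fun y => ?_) ?_
    · by_cases hy : |y.2.1.1| < 1
      · rw [suspSnd, dif_pos hy, norm_smul, Real.norm_eq_abs, abs_of_pos (by linarith)]
        exact mul_le_mul_of_nonneg_left (hC _ (f _ _).2) (by linarith)
      · have hy1 : |y.2.1.1| = 1 := le_antisymm (susp_abs_le _) (not_lt.1 hy)
        rw [suspSnd, dif_neg hy, hy1]
        simp
    · have : Continuous fun y : P × susp A => (1 - |y.2.1.1|) * C := by fun_prop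
      have h2 := this.tendsto x
      rwa [h1, sub_self, zero_mul] at h2

/-- The suspension of a continuous map. -/
noncomputable def suspMap {A : Set E} {B : Set E'} (hB : Bornology.IsBounded B) (f : C(A, B)) :
    C(susp A, susp B) where
  toFun := suspFun f
  continuous_toFun := by
    have := continuous_suspFun hB (fun _ : Unit => f) (by fun_prop)
    exact this.comp (Continuous.prodMk continuous_const continuous_id : Continuous fun q => ((), q))

theorem suspMap_homotopic {A : Set E} {B : Set E'} (hB : Bornology.IsBounded B) {f g : C(A, B)}
    (h : f.Homotopic g) : (suspMap hB f).Homotopic (suspMap hB g) := by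
  obtain ⟨H⟩ := h
  refine ⟨⟨⟨fun x => suspFun (fun a => H (x.1, a)) x.2,
    continuous_suspFun hB (fun (s : I) (a : A) => H (s, a)) H.continuous⟩, fun q => ?_,
    fun q => ?_⟩⟩
  · simp [suspMap]
  · simp [suspMap]

/-- Suspensions of homotopy equivalent bounded sets are homotopy equivalent. -/
theorem susp_homotopyEquiv {A : Set E} {B : Set E'} (hA : Bornology.IsBounded A)
    (hB : Bornology.IsBounded B) (e : ContinuousMap.HomotopyEquiv A B) :
    Nonempty (ContinuousMap.HomotopyEquiv (susp A) (susp B)) := by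
  refine ⟨⟨suspMap hB e.toFun, suspMap hA e.invFun, ?_, ?_⟩⟩
  · have := suspMap_homotopic hA e.left_inv
    convert this using 1
    · ext1 q
      exact (suspFun_comp _ _ q).symm
    · ext1 q
      exact (suspFun_id q).symm
  · have := suspMap_homotopic hB e.right_inv
    convert this using 1
    · ext1 q
      exact (suspFun_comp _ _ q).symm
    · ext1 q
      exact (suspFun_id q).symm

/-- The suspension of a bounded contractible set is contractible. -/
theorem contractibleSpace_susp {A : Set E} (hA : Bornology.IsBounded A) [ContractibleSpace A] :
    ContractibleSpace (susp A) := by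
  have e : Nonempty (ContinuousMap.HomotopyEquiv A ({0} : Set ℝ)) :=
    ContractibleSpace.hequiv _ _
  obtain ⟨e⟩ := susp_homotopyEquiv hA Bornology.isBounded_singleton e.some
  -- The suspension of the point `0` is the segment from `(-1, 0)` to `(1, 0)`.
  have hs : StarConvex ℝ (0 : ℝ × ℝ) (susp ({0} : Set ℝ)) := by
    rw [starConvex_zero_iff]
    rintro ⟨t, z⟩ hq a ha0 ha1
    have hq' : |t| ≤ 1 ∧ z = 0 := by
      rcases hq with ⟨h, h'⟩ | ⟨h, h'⟩
      · exact ⟨h.le, h'⟩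
      · refine ⟨h.le, ?_⟩
        simp only [smul_eq_mul, Set.mem_singleton_iff, mul_eq_zero, inv_eq_zero] at h h'
        exact h'.resolve_left (by linarith)
    obtain ⟨ht, rfl⟩ := hq'
    have : |a * t| ≤ 1 := by
      rw [abs_mul, abs_of_nonneg ha0]
      exact mul_le_one₀ ha1 (abs_nonneg _) ht
    rcases this.lt_or_eq with h | h
    · exact Or.inr ⟨h, by simp⟩
    · exact Or.inl ⟨h, by simp⟩
  have : ContractibleSpace (susp ({0} : Set ℝ)) := hs.contractibleSpace ⟨(1, 0), Or.inl (by simp)⟩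
  exact e.contractibleSpace

/-- Radial projection of the unit sphere of a positively homogeneous function. -/
noncomputable def homogeneousSphereHomeomorph (e : E ≃L[ℝ] E') (N : E → ℝ) (hN : Continuous N)
    (hpos : ∀ x, x ≠ 0 → 0 < N x) (hsmul : ∀ (c : ℝ) (x), 0 < c → N (c • x) = c * N x) :
    {x : E | x ≠ 0 ∧ N x = 1} ≃ₜ Metric.sphere (0 : E') 1 where
  toFun x := ⟨‖e x‖⁻¹ • e x, by
    have : e x ≠ 0 := fun h => x.2.1 (e.map_eq_zero_iff.1 h)
    simp [norm_smul, this]⟩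
  invFun y := ⟨(N (e.symm y))⁻¹ • e.symm y, by
    have h0 : e.symm (y : E') ≠ 0 := fun h => by
      have := e.symm.map_eq_zero_iff.1 h
      have h1 := y.2
      simp [this] at h1
    have := hpos _ h0
    refine ⟨smul_ne_zero (inv_ne_zero this.ne') h0, ?_⟩
    rw [hsmul _ _ (inv_pos.2 this), inv_mul_cancel₀ this.ne']⟩
  left_inv := by
    rintro ⟨x, hx0, hx⟩
    have : 0 < ‖e x‖ := norm_pos_iff.2 fun h => hx0 (e.map_eq_zero_iff.1 h)
    refine Subtype.ext ?_
    simp only [map_smul, ContinuousLinearEquiv.symm_apply_apply]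
    rw [hsmul _ _ (inv_pos.2 this), hx, mul_one, inv_inv, smul_smul, mul_inv_cancel₀ this.ne',
      one_smul]
  right_inv := by
    rintro ⟨y, hy⟩
    have hy1 : ‖y‖ = 1 := by simpa using hy
    have h0 : e.symm y ≠ 0 := fun h => by
      have := e.symm.map_eq_zero_iff.1 h
      simp [this] at hy1
    have := hpos _ h0
    refine Subtype.ext ?_
    simp only [map_smul, ContinuousLinearEquiv.apply_symm_apply, norm_smul, hy1, mul_one]
    rw [smul_smul, norm_inv, inv_inv, Real.norm_of_nonneg this.le, mul_inv_cancel₀ this.ne',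
      one_smul]
  continuous_toFun := by
    refine Continuous.subtype_mk (Continuous.smul (Continuous.inv₀ (by fun_prop) fun x => ?_)
      (by fun_prop)) _
    exact norm_ne_zero_iff.2 fun h => x.2.1 (e.map_eq_zero_iff.1 h)
  continuous_invFun := by
    refine Continuous.subtype_mk (Continuous.smul (Continuous.inv₀ (by fun_prop) fun y => ?_)
      (by fun_prop)) _
    refine (hpos _ fun h => ?_).ne'
    have := e.symm.map_eq_zero_iff.1 h
    have h1 := y.2
    simp [this] at h1

/-- The suspension of a sphere is a sphere. -/
theorem susp_sphere_homeomorph (k : ℕ) :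
    Nonempty (susp (Metric.sphere (0 : EuclideanSpace ℝ (Fin k)) 1) ≃ₜ
      Metric.sphere (0 : EuclideanSpace ℝ (Fin (k + 1))) 1) := by
  let e : (ℝ × EuclideanSpace ℝ (Fin k)) ≃L[ℝ] EuclideanSpace ℝ (Fin (k + 1)) :=
    ContinuousLinearEquiv.ofFinrankEq (by simp [add_comm])
  -- In this model the suspension is the unit sphere of the sum norm, which projects radially onto
  -- the Euclidean one. For `k = 0` it consists of the two apices.
  have hs : susp (Metric.sphere (0 : EuclideanSpace ℝ (Fin k)) 1) =
      {x | x ≠ 0 ∧ |x.1| + ‖x.2‖ = 1} := by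
    ext ⟨t, z⟩
    simp only [susp, Set.mem_ofPred_eq, mem_sphere_zero_iff_norm, norm_smul, norm_inv,
      Real.norm_eq_abs]
    constructor
    · rintro (⟨h, rfl⟩ | ⟨h, h'⟩)
      · refine ⟨fun h0 => ?_, by simp [h]⟩
        simp_all
      · rw [abs_of_pos (by linarith : 0 < 1 - |t|), inv_mul_eq_one₀ (by linarith)] at h'
        refine ⟨fun h0 => ?_, by linarith⟩
        simp_all
    · rintro ⟨-, h⟩
      have hz := norm_nonneg z
      rcases hz.eq_or_lt with h0 | h0
      · exact Or.inl ⟨by linarith, norm_eq_zero.1 h0.symm⟩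
      · have : |t| < 1 := by linarith
        refine Or.inr ⟨this, ?_⟩
        rw [abs_of_pos (by linarith : 0 < 1 - |t|), inv_mul_eq_one₀ (by linarith)]
        linarith
  rw [hs]
  refine ⟨homogeneousSphereHomeomorph e (fun x => |x.1| + ‖x.2‖) (by fun_prop) ?_ ?_⟩
  · rintro ⟨t, z⟩ h
    have h1 := abs_nonneg t
    have h2 := norm_nonneg z
    refine lt_of_le_of_ne (by positivity) fun h0 => h ?_
    have h3 : |t| = 0 := by simp only at h0; linarith
    have h4 : ‖z‖ = 0 := by simp only at h0; linarith
    exact Prod.ext (abs_eq_zero.1 h3) (norm_eq_zero.1 h4)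
  · rintro c ⟨t, z⟩ hc
    simp [abs_mul, norm_smul, abs_of_pos hc]
    ring

end TopologicalSuspension

/-! ### Barycentric coordinates and straight-line homotopies -/

namespace SimplComplex

variable {X : Type*} [DecidableEq X]

theorem mem_realization [Fintype X] {Δ : SimplComplex X} {x : X → ℝ} :
    x ∈ Δ.realization ↔
      (∀ i, 0 ≤ x i) ∧ ∑ i, x i = 1 ∧ ∃ σ ∈ Δ.faces, ∀ i, x i ≠ 0 → i ∈ σ := by
  simp only [realization, Set.mem_iUnion, exists_prop]
  constructor
  · rintro ⟨σ, hσ, hx⟩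
    have hsub : convexHull ℝ ((fun x : X => (Pi.single x 1 : X → ℝ)) '' (σ : Set X)) ⊆
        {x | (∀ i, 0 ≤ x i) ∧ ∑ i, x i = 1 ∧ ∀ i, i ∉ σ → x i = 0} := by
      refine convexHull_min ?_ ?_
      · rintro _ ⟨a, ha, rfl⟩
        refine ⟨fun i => ?_, by simp, fun i hi => ?_⟩
        · simp only [Pi.single_apply]
          split_ifs <;> norm_num
        · exact Pi.single_eq_of_ne (by rintro rfl; exact hi ha) _
      · rintro y ⟨hy0, hy1, hy2⟩ z ⟨hz0, hz1, hz2⟩ a b ha hb hab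
        refine ⟨fun i => ?_, ?_, fun i hi => ?_⟩
        · exact add_nonneg (mul_nonneg ha (hy0 i)) (mul_nonneg hb (hz0 i))
        · simp [Finset.sum_add_distrib, ← Finset.mul_sum, hy1, hz1, hab]
        · simp [hy2 i hi, hz2 i hi]
    obtain ⟨h0, h1, h2⟩ := hsub hx
    exact ⟨h0, h1, σ, hσ, fun i hi => by_contra fun h => hi (h2 i h)⟩
  · rintro ⟨h0, h1, σ, hσ, h2⟩
    refine ⟨σ, hσ, ?_⟩
    have hz : ∀ i ∉ σ, x i = 0 := fun i hi => by_contra fun h => hi (h2 i h)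
    have hx : x = ∑ i ∈ σ, x i • (Pi.single i 1 : X → ℝ) := by
      funext j
      by_cases hj : j ∈ σ
      · simp [Finset.sum_apply, Pi.single_apply, hj]
      · simp [Finset.sum_apply, Pi.single_apply, hj, hz j hj]
    rw [hx]
    refine (convex_convexHull ℝ _).sum_mem (fun i _ => h0 i) ?_
      fun i hi => subset_convexHull ℝ _ ⟨i, hi, rfl⟩
    rw [← h1]
    exact Finset.sum_subset (Finset.subset_univ _) fun i _ hi => hz i hi

end SimplComplex

/-- Two maps into a subset of a normed space that are joined by segments inside the subset are
homotopic. -/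
theorem ContinuousMap.homotopic_of_segment {Y E : Type*} [TopologicalSpace Y]
    [NormedAddCommGroup E] [NormedSpace ℝ E] {A : Set E} (f g : C(Y, A))
    (h : ∀ y, ∀ s t : ℝ, 0 ≤ s → 0 ≤ t → s + t = 1 → s • (f y : E) + t • (g y : E) ∈ A) :
    f.Homotopic g := by
  refine ⟨⟨⟨fun p => ⟨(1 - (p.1 : ℝ)) • (f p.2 : E) + (p.1 : ℝ) • (g p.2 : E),
    h p.2 _ _ (by linarith [p.1.2.2]) p.1.2.1 (by ring)⟩, by fun_prop⟩, fun y => ?_, fun y => ?_⟩⟩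
  · exact Subtype.ext (by simp)
  · exact Subtype.ext (by simp)

/-! ### Independence complexes of induced subgraphs -/

namespace SimpleGraph

open SimplComplex TopologicalSuspension

variable {V : Type*}

/-- The independence complex of the subgraph induced on `S`, as a complex on `V`. -/
def indOn (F : SimpleGraph V) (S : Finset V) : SimplComplex V where
  faces := {σ | σ ⊆ S ∧ F.IsIndepSet (σ : Set V)}
  down_closed := fun h hτ => ⟨hτ.trans h.1, Set.Pairwise.mono (Finset.coe_subset.mpr hτ) h.2⟩

theorem indOn_univ [Fintype V] (F : SimpleGraph V) : F.indOn Finset.univ = F.indComplex := by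
  ext σ
  simp [indOn, indComplex]

theorem indOn_faces_mono (F : SimpleGraph V) {S T : Finset V} (h : S ⊆ T) :
    (F.indOn S).faces ⊆ (F.indOn T).faces := fun _ hσ => ⟨hσ.1.trans h, hσ.2⟩

theorem dominatesOn_univ_iff [Fintype V] {F : SimpleGraph V} {D : Finset V} :
    F.DominatesOn Finset.univ D ↔ F.IsDominatingSet (D : Set V) := by
  simp only [DominatesOn, Finset.subset_univ, Finset.mem_univ, true_and, forall_true_left,
    IsDominatingSet, closedNbhd, Set.eq_univ_iff_forall, Set.mem_union, Set.mem_ofPred_eq,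
    Finset.mem_coe]
  exact forall_congr' fun x => or_comm

variable [DecidableEq V]

/-- Together with `deletion_indOn`, this keeps the grape recursion within induced subgraphs of `F`.
-/
theorem link_indOn (F : SimpleGraph V) {S : Finset V} {a : V} (ha : a ∈ S) :
    (F.indOn S).link {a} = F.indOn (F.removeNbhd S a) := by
  ext m
  simp only [link, indOn, Set.mem_ofPred_eq]
  constructor
  · rintro ⟨⟨h1, h2⟩, h3, h4, h5⟩
    refine ⟨fun x hx => ?_, h2⟩
    have hxa : x ≠ a := by
      rintro rfl
      have : x ∈ ({x} : Finset V) ∩ m := by simp [hx]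
      simp [h3] at this
    exact mem_removeNbhd.2 ⟨h1 hx, hxa, h5 (by simp) (by simp [hx]) hxa.symm⟩
  · rintro ⟨h1, h2⟩
    have h1' : ∀ x ∈ m, x ∈ S ∧ x ≠ a ∧ ¬ F.Adj a x := fun x hx => mem_removeNbhd.1 (h1 hx)
    refine ⟨⟨fun x hx => (h1' x hx).1, h2⟩, ?_, ?_, ?_⟩
    · exact Finset.singleton_inter_of_notMem fun h => (h1' a h).2.1 rfl
    · exact Finset.union_subset (fun x hx => (h1' x hx).1) (by simpa using ha)
    · rw [Finset.coe_union, Finset.coe_singleton, Set.union_singleton]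
      exact h2.insert fun b hb _ => ⟨(h1' b hb).2.2, fun h => (h1' b hb).2.2 h.symm⟩

theorem deletion_indOn (F : SimpleGraph V) (S : Finset V) (a : V) :
    (F.indOn S).deletion {a} = F.indOn (S.erase a) := by
  ext m
  simp only [deletion, indOn, Set.mem_ofPred_eq, Finset.singleton_subset_iff, Finset.subset_erase]
  tauto

theorem removeNbhd_subset_erase (F : SimpleGraph V) (S : Finset V) (a : V) :
    F.removeNbhd S a ⊆ S.erase a := fun x hx => by
  rw [mem_removeNbhd] at hx
  exact Finset.mem_erase.2 ⟨hx.2.1, hx.1⟩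

variable [Fintype V]

/-- Independence is a condition on pairs, so the support of `x` can itself serve as the face. -/
theorem mem_realization_indOn {F : SimpleGraph V} {S : Finset V} {x : V → ℝ} :
    x ∈ (F.indOn S).realization ↔ (∀ i, 0 ≤ x i) ∧ ∑ i, x i = 1 ∧ (∀ i, x i ≠ 0 → i ∈ S) ∧
      ∀ i j, x i ≠ 0 → x j ≠ 0 → ¬ F.Adj i j := by
  rw [mem_realization]
  refine and_congr_right fun _ => and_congr_right fun _ => ⟨?_, ?_⟩
  · rintro ⟨σ, ⟨h1, h2⟩, h3⟩
    exact ⟨fun i hi => h1 (h3 i hi), fun i j hi hj hij => h2 (h3 i hi) (h3 j hj) hij.ne hij⟩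
  · rintro ⟨h1, h2⟩
    refine ⟨Finset.univ.filter fun i => x i ≠ 0, ⟨fun i hi => ?_, fun i hi j hj _ => ?_⟩, ?_⟩
    · exact h1 i (by simpa using hi)
    · exact h2 i j (by simpa using hi) (by simpa using hj)
    · simp

theorem isBounded_realization_indOn (F : SimpleGraph V) (S : Finset V) :
    Bornology.IsBounded (F.indOn S).realization :=
  (bounded_stdSimplex V).subset fun _ hx =>
    ⟨(mem_realization_indOn.1 hx).1, (mem_realization_indOn.1 hx).2.1⟩

/-- If the subgraph induced on `S` has an isolated vertex, then its independence complex is a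
cone. -/
theorem contractibleSpace_realization_indOn {F : SimpleGraph V} {S : Finset V} {u : V}
    (hu : u ∈ S) (hiso : ∀ x ∈ S, ¬ F.Adj u x) : ContractibleSpace (F.indOn S).realization := by
  have hmem : (Pi.single u 1 : V → ℝ) ∈ (F.indOn S).realization := by
    have hne : ∀ i, (Pi.single u 1 : V → ℝ) i ≠ 0 → i = u := fun i hi =>
      by_contra fun h => hi (Pi.single_eq_of_ne h _)
    refine mem_realization_indOn.2 ⟨fun i => ?_, by simp, fun i hi => hne i hi ▸ hu,
      fun i j hi hj => ?_⟩
    · simp only [Pi.single_apply]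
      split_ifs <;> norm_num
    · rw [hne i hi, hne j hj]
      exact F.loopless.irrefl u
  have hs : StarConvex ℝ (Pi.single u 1 : V → ℝ) (F.indOn S).realization := by
    intro y hy a b ha hb hab
    obtain ⟨h0, h1, h2, h3⟩ := mem_realization_indOn.1 hy
    have hne : ∀ i, (a • (Pi.single u 1 : V → ℝ) + b • y) i ≠ 0 → i = u ∨ y i ≠ 0 := by
      intro i hi
      by_contra! hcon
      exact hi (by simp [Pi.single_eq_of_ne hcon.1, hcon.2])
    refine mem_realization_indOn.2 ⟨fun i => ?_, ?_, fun i hi => ?_, fun i j hi hj hij => ?_⟩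
    · exact add_nonneg (mul_nonneg ha ((mem_realization_indOn.1 hmem).1 i))
        (mul_nonneg hb (h0 i))
    · simp [Finset.sum_add_distrib, ← Finset.mul_sum, h1, hab]
    · rcases hne i hi with rfl | h
      exacts [hu, h2 i h]
    · rcases hne i hi with rfl | hi' <;> rcases hne j hj with rfl | hj'
      · exact hij.ne rfl
      · exact hiso j (h2 j hj') hij
      · exact hiso i (h2 i hi') hij.symm
      · exact h3 i j hi' hj' hij
  exact hs.contractibleSpace ⟨_, hmem⟩

theorem mem_susp_realization_indOn {F : SimpleGraph V} {T : Finset V} {q : ℝ × (V → ℝ)} :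
    q ∈ susp (F.indOn T).realization ↔ |q.1| ≤ 1 ∧ (∀ i, 0 ≤ q.2 i) ∧ ∑ i, q.2 i = 1 - |q.1| ∧
      (∀ i, q.2 i ≠ 0 → i ∈ T) ∧ ∀ i j, q.2 i ≠ 0 → q.2 j ≠ 0 → ¬ F.Adj i j := by
  obtain ⟨t, z⟩ := q
  simp only [susp, Set.mem_ofPred_eq]
  constructor
  · rintro (⟨h, rfl⟩ | ⟨h, h'⟩)
    · simp [h]
    · have hp : 0 < 1 - |t| := by linarith
      obtain ⟨h0, h1, h2, h3⟩ := mem_realization_indOn.1 h'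
      have hne : ∀ i, z i ≠ 0 → ((1 - |t|)⁻¹ • z) i ≠ 0 := fun i hi =>
        mul_ne_zero (inv_ne_zero hp.ne') hi
      refine ⟨h.le, fun i => ?_, ?_, fun i hi => h2 i (hne i hi),
        fun i j hi hj => h3 i j (hne i hi) (hne j hj)⟩
      · exact nonneg_of_mul_nonneg_right (h0 i) (inv_pos.2 hp)
      · simp only [Pi.smul_apply, smul_eq_mul, ← Finset.mul_sum] at h1
        rw [inv_mul_eq_one₀ hp.ne'] at h1
        exact h1.symm
  · rintro ⟨h, h0, h1, h2, h3⟩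
    rcases h.lt_or_eq with h | h
    · have hp : 0 < 1 - |t| := by linarith
      have hne : ∀ i, ((1 - |t|)⁻¹ • z) i ≠ 0 → z i ≠ 0 := fun i hi h => hi (by simp [h])
      refine Or.inr ⟨h, mem_realization_indOn.2 ⟨fun i => ?_, ?_, fun i hi => h2 i (hne i hi),
        fun i j hi hj => h3 i j (hne i hi) (hne j hj)⟩⟩
      · exact mul_nonneg (inv_pos.2 hp).le (h0 i)
      · simp only [Pi.smul_apply, smul_eq_mul, ← Finset.mul_sum]
        rw [h1, inv_mul_cancel₀ hp.ne']
    · refine Or.inl ⟨h, funext fun i => ?_⟩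
      rw [h, sub_self] at h1
      exact (Finset.sum_eq_zero_iff_of_nonneg fun i _ => h0 i).1 h1 i (Finset.mem_univ i)

/-- If `u` is a leaf with neighbour `w`, then the independence complex is homotopy equivalent to
the suspension of the link of `w`: all neighbours of `w` can be folded onto `u`. -/
theorem indOn_homotopyEquiv_susp {F : SimpleGraph V} {S : Finset V} {u w : V}
    (hu : u ∈ S) (hw : w ∈ S) (huw : F.Adj u w) (hul : F.IsLeafIn S u) :
    Nonempty (ContinuousMap.HomotopyEquiv (F.indOn S).realization
      (susp (F.indOn (F.removeNbhd S w)).realization)) := by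
  classical
  set T := F.removeNbhd S w with hT
  have huT : u ∉ T := fun h => (mem_removeNbhd.1 h).2.2 huw.symm
  have hwT : w ∉ T := fun h => (mem_removeNbhd.1 h).2.1 rfl
  have hTS : ∀ {i}, i ∈ T → i ∈ S := fun h => (mem_removeNbhd.1 h).1
  have hul' : ∀ i ∈ S, F.Adj u i → i = w := fun i hi h => hul i hi w hw h huw
  -- `N` is the total weight on the neighbours of `w`, and `R` the restriction to `T`. The map to
  -- the suspension is `x ↦ (N x - x w, R x)`; its homotopy inverse `g` puts the positive part of
  -- the height on `u` and the negative part on `w`.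
  let N : (V → ℝ) → ℝ := fun x => ∑ i ∈ S.filter (F.Adj w), x i
  let R : (V → ℝ) → V → ℝ := fun x i => if i ∈ T then x i else 0
  let g : ℝ × (V → ℝ) → V → ℝ := fun q i =>
    q.2 i + (if i = u then max q.1 0 else 0) + (if i = w then max (-q.1) 0 else 0)
  have hNc : Continuous N := by fun_prop
  have hRc : Continuous R := by
    refine continuous_pi fun i => ?_
    by_cases hi : i ∈ T
    · simp only [R, hi, if_true]; fun_prop
    · simp only [R, hi, if_false]; fun_prop
  have hgc : Continuous g := by
    refine continuous_pi fun i => ?_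
    refine Continuous.add (Continuous.add (by fun_prop) ?_) ?_
    · exact continuous_if_const _ (fun _ => by fun_prop) fun _ => continuous_const
    · exact continuous_if_const _ (fun _ => by fun_prop) fun _ => continuous_const
  have hN0 : ∀ x ∈ (F.indOn S).realization, 0 ≤ N x := fun x hx =>
    Finset.sum_nonneg fun i _ => (mem_realization_indOn.1 hx).1 i
  -- weight on `w` and weight on its neighbours exclude each other
  have hexcl : ∀ x ∈ (F.indOn S).realization, N x ≠ 0 → x w = 0 := by
    intro x hx hN
    obtain ⟨i, hi, hxi⟩ := Finset.exists_ne_zero_of_sum_ne_zero hN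
    by_contra hxw
    exact (mem_realization_indOn.1 hx).2.2.2 w i hxw hxi (Finset.mem_filter.1 hi).2
  have hmax : ∀ x ∈ (F.indOn S).realization,
      max (N x - x w) 0 = N x ∧ max (-(N x - x w)) 0 = x w ∧ |N x - x w| = N x + x w := by
    intro x hx
    have h0 := hN0 x hx
    have h1 := (mem_realization_indOn.1 hx).1 w
    by_cases hN : N x = 0
    · simp [hN, h1, abs_of_nonneg h1]
    · simp [hexcl x hx hN, h0, abs_of_nonneg h0]
  have hsum : ∀ x ∈ (F.indOn S).realization, ∑ i, R x i = 1 - (N x + x w) := by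
    intro x hx
    obtain ⟨-, h1, h2, -⟩ := mem_realization_indOn.1 hx
    have hpt : ∀ i, x i = R x i + (if i ∈ S.filter (F.Adj w) then x i else 0) +
        (if i = w then x i else 0) := by
      intro i
      by_cases hxi : x i = 0
      · simp [R, hxi]
      have hiS := h2 i hxi
      by_cases hiw : i = w
      · subst hiw
        simp [R, hwT]
      · by_cases hwi : F.Adj w i
        · have : i ∉ T := fun h => (mem_removeNbhd.1 h).2.2 hwi
          simp [R, this, hiS, hwi, hiw]
        · have : i ∈ T := mem_removeNbhd.2 ⟨hiS, hiw, hwi⟩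
          simp [R, this, hwi, hiw]
    have := Finset.sum_congr rfl fun i (_ : i ∈ Finset.univ) => hpt i
    have hNx : ∑ i, (if i ∈ S.filter (F.Adj w) then x i else 0) = N x := by
      rw [Finset.sum_ite_mem, Finset.univ_inter]
    rw [h1, Finset.sum_add_distrib, Finset.sum_add_distrib, hNx,
      Finset.sum_ite_eq' Finset.univ w, if_pos (Finset.mem_univ w)] at this
    linarith
  have hRne : ∀ x i, R x i ≠ 0 → i ∈ T ∧ x i ≠ 0 := by
    intro x i hi
    by_cases h : i ∈ T
    · exact ⟨h, by simpa [R, h] using hi⟩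
    · simp [R, h] at hi
  have hf : ∀ x ∈ (F.indOn S).realization, (N x - x w, R x) ∈ susp (F.indOn T).realization := by
    intro x hx
    have hx' := mem_realization_indOn.1 hx
    have hR0 : ∀ i, 0 ≤ R x i := fun i => by
      simp only [R]; split_ifs
      exacts [hx'.1 i, le_rfl]
    rw [mem_susp_realization_indOn]
    simp only
    rw [(hmax x hx).2.2]
    refine ⟨?_, hR0, hsum x hx, fun i hi => (hRne x i hi).1,
      fun i j hi hj => hx'.2.2.2 i j (hRne x i hi).2 (hRne x j hj).2⟩
    have := Finset.sum_nonneg fun i (_ : i ∈ Finset.univ) => hR0 i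
    rw [hsum x hx] at this
    linarith
  have hg : ∀ q ∈ susp (F.indOn T).realization, g q ∈ (F.indOn S).realization := by
    rintro ⟨t, z⟩ hq
    obtain ⟨h, h0, h1, h2, h3⟩ := mem_susp_realization_indOn.1 hq
    simp only at h h0 h1 h2 h3
    have hne : ∀ i, g (t, z) i ≠ 0 → i ∈ T ∧ z i ≠ 0 ∨ i = u ∧ 0 < t ∨ i = w ∧ t < 0 := by
      intro i hi
      by_contra! hcon
      obtain ⟨c1, c2, c3⟩ := hcon
      have hz : z i = 0 := by
        by_contra hz
        exact hz (c1 (h2 i hz))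
      refine hi ?_
      simp only [g, hz]
      by_cases hiu : i = u
      · have hiw : i ≠ w := hiu ▸ huw.ne
        simp [hiw, c2 hiu]
      · by_cases hiw : i = w
        · simp [hiu, c3 hiw]
        · simp [hiu, hiw]
    have hTn : ∀ i ∈ T, ¬ F.Adj u i ∧ ¬ F.Adj w i := fun i hi =>
      ⟨fun h => (mem_removeNbhd.1 hi).2.1 (hul' i (hTS hi) h), (mem_removeNbhd.1 hi).2.2⟩
    refine mem_realization_indOn.2 ⟨fun i => ?_, ?_, fun i hi => ?_, fun i j hi hj hij => ?_⟩
    · have : 0 ≤ z i := h0 i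
      simp only [g]
      split_ifs <;> positivity
    · simp only [g, Finset.sum_add_distrib, h1, Finset.sum_ite_eq', Finset.mem_univ, if_true]
      rcases le_total 0 t with ht | ht
      · simp [ht, abs_of_nonneg ht]
      · simp [ht, abs_of_nonpos ht]
    · rcases hne i hi with h | h | h
      exacts [hTS h.1, h.1 ▸ hu, h.1 ▸ hw]
    · rcases hne i hi with hi | hi | hi <;> rcases hne j hj with hj | hj | hj
      · exact h3 i j hi.2 hj.2 hij
      · exact (hTn i hi.1).1 (hj.1 ▸ hij.symm)
      · exact (hTn i hi.1).2 (hj.1 ▸ hij.symm)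
      · exact (hTn j hj.1).1 (hi.1 ▸ hij)
      · exact hij.ne (hi.1.trans hj.1.symm)
      · linarith [hi.2, hj.2]
      · exact (hTn j hj.1).2 (hi.1 ▸ hij)
      · linarith [hi.2, hj.2]
      · exact hij.ne (hi.1.trans hj.1.symm)
  let fc : C((F.indOn S).realization, susp (F.indOn T).realization) :=
    ⟨fun x => ⟨(N x - (x : V → ℝ) w, R x), hf x x.2⟩,
      Continuous.subtype_mk (Continuous.prodMk
        ((hNc.comp continuous_subtype_val).sub
          ((continuous_apply w).comp continuous_subtype_val))
        (hRc.comp continuous_subtype_val)) _⟩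
  let gc : C(susp (F.indOn T).realization, (F.indOn S).realization) :=
    ⟨fun q => ⟨g q, hg q q.2⟩, Continuous.subtype_mk (hgc.comp continuous_subtype_val) _⟩
  refine ⟨⟨fc, gc, ?_, ?_⟩⟩
  -- The composite moves the weight on the neighbours of `w` to `u`, so it enlarges the support at
  -- most by `u`, and only if `N x ≠ 0`. Then `x w = 0`, and `w` is the only neighbour of `u` in
  -- `S`, so the union of supports stays independent.
  · refine ContinuousMap.homotopic_of_segment _ _ ?_
    rintro ⟨x, hx⟩ s t hs ht hst
    have hy := hg _ (hf x hx)
    change s • g (N x - x w, R x) + t • x ∈ _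
    obtain ⟨a0, a1, a2, a3⟩ := mem_realization_indOn.1 hx
    obtain ⟨b0, b1, b2, b3⟩ := mem_realization_indOn.1 hy
    have hgne : ∀ i, g (N x - x w, R x) i ≠ 0 → x i ≠ 0 ∨ i = u ∧ N x ≠ 0 := by
      intro i hi
      by_contra! hcon
      refine hi ?_
      have hRi : R x i = 0 := by simp [R, hcon.1]
      simp only [g, (hmax x hx).1, (hmax x hx).2.1, hRi]
      by_cases hiu : i = u
      · have hiw : i ≠ w := hiu ▸ huw.ne
        simp [hiw, hcon.2 hiu]
      · by_cases hiw : i = w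
        · subst hiw
          simp [hiu, hcon.1]
        · simp [hiu, hiw]
    have hne : ∀ i, (s • g (N x - x w, R x) + t • x) i ≠ 0 → x i ≠ 0 ∨ i = u ∧ N x ≠ 0 := by
      intro i hi
      by_contra hcon
      have h1 : g (N x - x w, R x) i = 0 := by_contra fun h => hcon (hgne i h)
      have h2 : x i = 0 := by_contra fun h => hcon (Or.inl h)
      exact hi (by simp [h1, h2])
    have hcross : ∀ j, N x ≠ 0 → x j ≠ 0 → ¬ F.Adj u j := by
      intro j hN hj huj
      exact hj (hul' j (a2 j hj) huj ▸ hexcl x hx hN)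
    refine mem_realization_indOn.2 ⟨fun i => ?_, ?_, fun i hi => ?_, fun i j hi hj hij => ?_⟩
    · exact add_nonneg (mul_nonneg hs (b0 i)) (mul_nonneg ht (a0 i))
    · simp only [Pi.add_apply, Pi.smul_apply, smul_eq_mul, Finset.sum_add_distrib,
        ← Finset.mul_sum]
      rw [a1, b1, mul_one, mul_one, hst]
    · rcases hne i hi with h | h
      exacts [a2 i h, h.1 ▸ hu]
    · rcases hne i hi with hi' | ⟨hi', hN⟩ <;> rcases hne j hj with hj' | ⟨hj', hN'⟩
      · exact a3 i j hi' hj' hij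
      · exact hcross i hN' hi' (hj' ▸ hij.symm)
      · exact hcross j hN hj' (hi' ▸ hij)
      · exact hij.ne (hi'.trans hj'.symm)
  -- This composite is the identity on the nose: `z` vanishes off `T`, so `u` is the only neighbour
  -- of `w` that can carry weight.
  · have : fc.comp gc = ContinuousMap.id _ := by
      ext1 q
      obtain ⟨⟨t, z⟩, hq⟩ := q
      obtain ⟨-, -, -, h2, -⟩ := mem_susp_realization_indOn.1 hq
      have hz : ∀ i, i ∉ T → z i = 0 := fun i hi => by_contra fun h => hi (h2 i h)
      have hNg : N (g (t, z)) = max t 0 := by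
        have huf : u ∈ S.filter (F.Adj w) := Finset.mem_filter.2 ⟨hu, huw.symm⟩
        simp only [N]
        rw [Finset.sum_eq_single_of_mem u huf]
        · simp [g, hz u huT, huw.ne]
        · intro i hi hiu
          have hwi := (Finset.mem_filter.1 hi).2
          simp [g, hz i fun h => (mem_removeNbhd.1 h).2.2 hwi, hiu, hwi.ne']
      have hgw : g (t, z) w = max (-t) 0 := by
        simp [g, hz w hwT, huw.ne']
      refine Subtype.ext (Prod.ext ?_ ?_)
      · change N (g (t, z)) - g (t, z) w = t
        rw [hNg, hgw]
        rcases le_total 0 t with ht | ht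
        · simp [ht]
        · simp [ht]
      · change R (g (t, z)) = z
        funext i
        by_cases hi : i ∈ T
        · have h1 : i ≠ u := fun h => huT (h ▸ hi)
          have h2 : i ≠ w := fun h => hwT (h ▸ hi)
          simp [R, g, hi, h1, h2]
        · simp [R, hi, hz i hi]
    rw [this]

/-! ### The grape property and the homotopy type -/

/-- The independence complex of an induced subgraph of a forest is a grape. -/
theorem IsAcyclic.isGrape_indOn {F : SimpleGraph V} (hF : F.IsAcyclic) (S : Finset V) :
    (F.indOn S).IsGrape := by
  induction S using Finset.strongInduction with
  | H S ih =>
    rcases le_or_gt S.card 1 with hS | hS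
    · refine IsGrape.of_at_most_one_vertex _ fun x y hx hy => ?_
      exact Finset.card_le_one.1 hS x (hx.1 (by simp)) y (hy.1 (by simp))
    have hex : ∃ a ∈ S, ∃ u ∈ S.erase a, ∀ x ∈ S.erase a, ¬ F.Adj u x := by
      by_cases hiso : ∃ u ∈ S, ∀ x ∈ S, ¬ F.Adj u x
      · obtain ⟨u, hu, h⟩ := hiso
        obtain ⟨a, ha, hau⟩ := Finset.exists_mem_ne hS u
        exact ⟨a, ha, u, Finset.mem_erase.2 ⟨hau.symm, hu⟩,
          fun x hx => h x (Finset.mem_of_mem_erase hx)⟩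
      · push Not at hiso
        obtain ⟨u, hu, hul⟩ := hF.exists_isLeafIn S (Finset.card_pos.1 (by omega))
        obtain ⟨w, hw, huw⟩ := hiso u hu
        refine ⟨w, hw, u, Finset.mem_erase.2 ⟨huw.ne, hu⟩, fun x hx hux => ?_⟩
        exact (Finset.mem_erase.1 hx).1 (hul x (Finset.mem_erase.1 hx).2 w hw hux huw)
    obtain ⟨a, ha, u, hu, hiso⟩ := hex
    have hlt : S.erase a ⊂ S := Finset.erase_ssubset ha
    have hsub := F.removeNbhd_subset_erase S a
    refine IsGrape.step _ a ?_ ?_ ?_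
    · rw [link_indOn F ha, deletion_indOn]
      refine ⟨indOn_faces_mono F hsub, Or.inr ?_⟩
      have := contractibleSpace_realization_indOn hu hiso
      -- The deletion is contractible, so its identity map, and with it any map into it, is
      -- nullhomotopic.
      have hid := (id_nullhomotopic (F.indOn (S.erase a)).realization).comp_left
        (ContinuousMap.inclusion (realization_mono (indOn_faces_mono F hsub)))
      rwa [ContinuousMap.id_comp] at hid
    · rw [deletion_indOn]
      exact ih _ hlt
    · rw [link_indOn F ha]
      exact ih _ (hsub.trans_ssubset hlt)

/-- The independence complex of an induced subgraph of a forest is contractible or a sphere, whose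
dimension is determined by dominating sets. -/
theorem IsAcyclic.indOn_contractible_or_sphere {F : SimpleGraph V} (hF : F.IsAcyclic)
    (S : Finset V) :
    ContractibleSpace (F.indOn S).realization ∨
      ∃ k, (∃ D, F.DominatesOn S D ∧ F.IsIndepSet (D : Set V) ∧ D.card = k) ∧
        (∀ D, F.DominatesOn S D → k ≤ D.card) ∧
        Nonempty (ContinuousMap.HomotopyEquiv (F.indOn S).realization
          (Metric.sphere (0 : EuclideanSpace ℝ (Fin k)) 1)) := by
  induction S using Finset.strongInduction with
  | H S ih =>
    by_cases hiso : ∃ u ∈ S, ∀ x ∈ S, ¬ F.Adj u x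
    · obtain ⟨u, hu, h⟩ := hiso
      exact Or.inl (contractibleSpace_realization_indOn hu h)
    push Not at hiso
    rcases S.eq_empty_or_nonempty with rfl | hne
    -- Without vertices the only face is `∅`: both the realization and the unit sphere of the zero
    -- space are empty.
    · refine Or.inr ⟨0, ⟨∅, ⟨by simp, by simp⟩, by simp [IsIndepSet], rfl⟩, by simp, ?_⟩
      have h1 : IsEmpty (F.indOn ∅).realization := by
        refine ⟨fun x => ?_⟩
        obtain ⟨-, h1, h2, -⟩ := mem_realization_indOn.1 x.2
        have h3 : ∀ i, (x : V → ℝ) i = 0 := fun i => by_contra fun h => by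
          simpa using h2 i h
        simp [h3] at h1
      have h2 : IsEmpty (Metric.sphere (0 : EuclideanSpace ℝ (Fin 0)) 1) := by
        refine ⟨fun x => ?_⟩
        have := x.2
        rw [mem_sphere_zero_iff_norm, Subsingleton.elim (x : EuclideanSpace ℝ (Fin 0)) 0] at this
        simp at this
      exact ⟨Homeomorph.empty.toHomotopyEquiv⟩
    obtain ⟨u, hu, w, hw, huw, hul, hend⟩ := hF.exists_end_leaf S hne hiso
    obtain ⟨e⟩ := indOn_homotopyEquiv_susp hu hw huw hul
    have hb := F.isBounded_realization_indOn (F.removeNbhd S w)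
    have hcontr : ContractibleSpace (F.indOn (F.removeNbhd S w)).realization →
        ContractibleSpace (F.indOn S).realization := by
      intro h
      have := contractibleSpace_susp hb
      exact e.contractibleSpace
    have hlt : F.removeNbhd S w ⊂ S :=
      (F.removeNbhd_subset_erase S w).trans_ssubset (Finset.erase_ssubset hw)
    rcases ih _ hlt with h | ⟨k, ⟨D, hD, hI, hk⟩, hmin, ⟨e'⟩⟩
    · exact Or.inl (hcontr h)
    -- The lower bound on dominating sets needs `T` to have no isolated vertex; the other case is a
    -- suspended cone.
    by_cases hisoT : ∃ x ∈ F.removeNbhd S w, ∀ y ∈ F.removeNbhd S w, ¬ F.Adj x y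
    · obtain ⟨x, hx, h⟩ := hisoT
      exact Or.inl (hcontr (contractibleSpace_realization_indOn hx h))
    push Not at hisoT
    refine Or.inr ⟨k + 1, ⟨insert w D, ?_⟩, fun D₁ hD₁ => ?_, ?_⟩
    · obtain ⟨h1, h2, h3⟩ := hD.insert_of_removeNbhd hw hI
      exact ⟨h1, h2, h3.trans (by rw [hk])⟩
    · obtain ⟨D', hD', hc⟩ := hD₁.exists_removeNbhd hu hw huw hul hend hisoT
      have := hmin D' hD'
      omega
    · obtain ⟨e₂⟩ := susp_homotopyEquiv hb Metric.isBounded_sphere e'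
      obtain ⟨e₃⟩ := susp_sphere_homeomorph k
      exact ⟨(e.trans e₂).trans e₃.toHomotopyEquiv⟩

end SimpleGraph

/-- For a finite forest `F`, the complex `Ind(F)` is a grape, and it is contractible or homotopy
equivalent to the sphere of dimension `i(F) - 1 = γ(F) - 1`, i.e. the unit sphere of the Euclidean
space of dimension `i(F) = γ(F)` (empty if that dimension is `0`). -/
theorem theorem4p7 {V : Type*} [Fintype V] [DecidableEq V] (F : SimpleGraph V)
    (hF : F.IsAcyclic) :
    F.indComplex.IsGrape ∧
      (ContractibleSpace F.indComplex.realization ∨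
        (F.indepDomNumber = F.domNumber ∧
          Nonempty (ContinuousMap.HomotopyEquiv F.indComplex.realization
            (Metric.sphere (0 : EuclideanSpace ℝ (Fin F.indepDomNumber)) 1)))) := by
  rw [← F.indOn_univ]
  refine ⟨hF.isGrape_indOn _, ?_⟩
  rcases hF.indOn_contractible_or_sphere Finset.univ with h | ⟨k, ⟨D, hD, hI, hk⟩, hmin, e⟩
  · exact Or.inl h
  have hD' := SimpleGraph.dominatesOn_univ_iff.1 hD
  -- The bound `hmin` covers all dominating sets and `D`, of size `k`, is independent, so both
  -- infima equal `k`.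
  have h1 : F.indepDomNumber = k := by
    refine IsLeast.csInf_eq ⟨⟨D, hI, hD', hk⟩, ?_⟩
    rintro n ⟨D₁, -, h, rfl⟩
    exact hmin D₁ (SimpleGraph.dominatesOn_univ_iff.2 h)
  have h2 : F.domNumber = k := by
    refine IsLeast.csInf_eq ⟨⟨D, hD', hk⟩, ?_⟩
    rintro n ⟨D₁, h, rfl⟩
    exact hmin D₁ (SimpleGraph.dominatesOn_univ_iff.2 h)
  refine Or.inr ⟨h1.trans h2.symm, ?_⟩
  rw [h1]
  exact e
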